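/- Let $\mathbb F_q$ be a finite field, $k\in\{2,3\}$, and let $n$ be an integer with $n-k>k$. Let $x_1,\dots,x_n\in\mathbb F_q$ be pairwise distinct (so $q\ge n$) and let $H_0=(x_j^{\,i-1})_{1\le i\le n-k,\,1\le j\le n}\in\mathbb F_q^{(n-k)\times n}$ be the corresponding Vandermonde matrix. For $\beta_1,\dots,\beta_k\in\mathbb F_{q^k}$ let $T\in\mathbb F_{q^k}^{k\times k}$ be the lower triangular Toeplitz matrix with first column $(\beta_1,\dots,\beta_k)^\top$, i.e. $T_{ij}=\beta_{i-j+1}$ for $i\ge j$ and $T_{ij}=0$ otherwise, let $$\hat X=\begin{bmatrix}0_{(n-2k)\times k}\\ T\end{bmatrix}\in\mathbb F_{q^k}^{(n-k)\times k},\qquad H_1=[\hat X\ \ 0_{(n-k)\times(n-k)}]\in\mathbb F_{q^k}^{(n-k)\times n}.$$ Assume: - if $k=2$: $\beta_1,\beta_2\in\mathbb F_{q^2}$ are linearly independent over $\mathbb F_q$; - if $k=3$: $\beta_1=a$, $\beta_2=a^2$, $\beta_3=1$ for some $a\in\mathbb F_{q^3}\setminus\mathbb F_q$ whose minimal polynomial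 over $\mathbb F_q$ has constant coefficient different from $-1$. Then $H(z)=H_0+H_1z\in\mathbb F_{q^k}[z]^{(n-k)\times n}$ is a parity-check matrix of an $(n,k,\delta)$ maximum distance profile (MDP) convolutional code over $\mathbb F_{q^k}$ with $\delta=k$. That is, $H(z)$ has full row rank, and $\mathcal C=\{v(z)\in\mathbb F_{q^k}[z]^n : H(z)v(z)^\top=0\}$ is a submodule of $\mathbb F_{q^k}[z]^n$ of rank $k$; the maximal degree of the $k\times k$ minors of a generator matrix of $\mathcal C$ (a $k\times n$ polynomial matrix of full row rank whose rows generate $\mathcal C$) is $\delta=k$; and, with $L=\lfloor\delta/k\rfloor+\lfloor\delta/(n-k)\rfloor$, the $L$-th column distance $$d_L^c(\mathcal C)=\min\Big\{\sum_{t=0}^{L}\mathrm{wt}(v_t)\ :\ v(z)=\sum_i v_iz^i\in\mathcal C,\ v_0\ne 0\Big\},$$ where $\mathrm{wt}$ is the Hamming weight, equals $(n-k)(L+1)+1$. -/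

import Mathlib

open Polynomial

/-- `A` is an `m × n` Vandermonde matrix: row `i` consists of the `i`-th powers of pairwise
distinct nodes `x₀, …, xₙ₋₁` of the field. -/
def IsVandermonde {F : Type*} [Field F] {m n : ℕ} (A : Matrix (Fin m) (Fin n) F) : Prop :=
  ∃ x : Fin n → F, Function.Injective x ∧ A = Matrix.of fun (i : Fin m) (j : Fin n) => x j ^ (i : ℕ)

/-- The `k × k` lower triangular Toeplitz matrix with first column `β`. -/
def toeplitzT {K : Type*} [Zero K] {k : ℕ} (β : Fin k → K) : Matrix (Fin k) (Fin k) K :=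
  Matrix.of fun i j => if j ≤ i then β ⟨(i : ℕ) - (j : ℕ), by omega⟩ else 0

/-- The `m × k` matrix whose last `k` rows are the Toeplitz matrix of `β` and whose first
`m - k` rows are zero (used for `k ≤ m`). -/
def xHat {K : Type*} [Zero K] {k : ℕ} (m : ℕ) (β : Fin k → K) : Matrix (Fin m) (Fin k) K :=
  Matrix.of fun i j =>
    if m - k ≤ (i : ℕ) then
      if h : (i : ℕ) - (m - k) < k then toeplitzT β ⟨(i : ℕ) - (m - k), h⟩ j else 0
    else 0

/-- The `m × n` matrix `[X 0]` whose first `k` columns are those of `X`. -/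
def padZeroCols {K : Type*} [Zero K] {m k : ℕ} (n : ℕ) (X : Matrix (Fin m) (Fin k) K) :
    Matrix (Fin m) (Fin n) K :=
  Matrix.of fun i j => if h : (j : ℕ) < k then X i ⟨j, h⟩ else 0

/-- The polynomial matrix `H₀ + H₁ z` over `K[z]`. -/
noncomputable def polyMatrix {K : Type*} [Field K] {m n : ℕ} (H₀ H₁ : Matrix (Fin m) (Fin n) K) :
    Matrix (Fin m) (Fin n) K[X] :=
  H₀.map C + (X : K[X]) • H₁.map C

/-- `G` is a generator matrix of `𝒞`: it has full row rank and `𝒞 = {u G | u ∈ K[z]^k}`. -/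
def IsGeneratorMatrix {K : Type*} [Field K] {k n : ℕ} (G : Matrix (Fin k) (Fin n) K[X])
    (𝒞 : Submodule K[X] (Fin n → K[X])) : Prop :=
  LinearIndependent K[X] G.row ∧
    ∀ v : Fin n → K[X], v ∈ 𝒞 ↔ ∃ u : Fin k → K[X], v = Matrix.vecMul u G

/-- `H` is a parity-check matrix of `𝒞`: it has `n - rank 𝒞` rows, has full row rank, and
`𝒞 = {v | H vᵀ = 0}`. -/
def IsParityCheckMatrix {K : Type*} [Field K] {r n : ℕ} (H : Matrix (Fin r) (Fin n) K[X])
    (𝒞 : Submodule K[X] (Fin n → K[X])) : Prop :=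
  r = n - Module.finrank K[X] 𝒞 ∧ LinearIndependent K[X] H.row ∧
    ∀ v : Fin n → K[X], v ∈ 𝒞 ↔ Matrix.mulVec H v = 0

/-- `𝒞` is an `(n, k, δ)` convolutional code over `K`: a submodule of `K[z]^n` of rank `k` with a
generator matrix whose full-size minors have maximal degree `δ`. (Two generator matrices of the
same code differ by a unimodular factor, so `δ` does not depend on the choice.) -/
def IsConvolutionalCode {K : Type*} [Field K] {n : ℕ} (𝒞 : Submodule K[X] (Fin n → K[X]))
    (k δ : ℕ) : Prop :=
  Module.finrank K[X] 𝒞 = k ∧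
    ∃ G : Matrix (Fin k) (Fin n) K[X], IsGeneratorMatrix G 𝒞 ∧
      IsGreatest {d : ℕ | ∃ f : Fin k ↪o Fin n, d = (G.submatrix id f).det.natDegree} δ

open Classical in
/-- The `j`-th column distance of `𝒞`: the minimum of `∑_{t ≤ j} wt(v_t)` over all
`v(z) = ∑ v_i z^i ∈ 𝒞` with `v_0 ≠ 0`. -/
noncomputable def columnDistance {K : Type*} [Field K] {n : ℕ}
    (𝒞 : Submodule K[X] (Fin n → K[X])) (j : ℕ) : ℕ :=
  sInf {w : ℕ | ∃ v ∈ 𝒞, (fun i => (v i).coeff 0) ≠ 0 ∧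
    w = ∑ t ∈ Finset.range (j + 1), hammingNorm (fun i => (v i).coeff t)}

/-- `𝒞` is an `(n, k, δ)` maximum distance profile (MDP) convolutional code. -/
def IsMDPCode {K : Type*} [Field K] {n : ℕ} (𝒞 : Submodule K[X] (Fin n → K[X]))
    (k δ : ℕ) : Prop :=
  IsConvolutionalCode 𝒞 k δ ∧
    columnDistance 𝒞 (δ / k + δ / (n - k)) = (n - k) * (δ / k + δ / (n - k) + 1) + 1

/-! ### Moments of vectors of low weight at distinct nodes of the small field -/

section Moments

variable {F K ι : Type*} [Field F] [Field K] [Algebra F K] [Fintype ι]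

/-! Put `m = n - k`. Since `k < m`, the relevant index is `L = 1`, and only the coefficients `v =
v₀` and `w = v₁` matter. They satisfy `H₀ v = 0` and `H₀ w = -H₁ v`: the first `m` moments of `v`
vanish, and those of `w` vanish except the last `k`, which are minus the Toeplitz matrix applied to
the first `k` entries of `v`.

Suppose `v ≠ 0` and the weights sum to at most `2m`. Then `wt v = m + s` with `1 ≤ s ≤ k`, and `wt w
≤ m - s`. Locator polynomials over `F` exploit both facts. Few nonzero entries of `v` force
`F`-linear relations among them (`exists_ratio`, `exists_relation_of_three`); few nonzero entries of
`w` force monic recurrences among its moments (`exists_moment_relation`). Combined, these contradict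
the independence of `β₁, β₂`, or yield a cubic for `a` that the hypothesis excludes, or make the
first `k` entries of `v` vanish, whence `v = 0` (`weight_bound_two`, `weight_bound_three`).

The rest is structural. The last `m` columns of `H` are constant and invertible, so the kernel has a
systematic generator linear in `z`. Invertibility of the Toeplitz matrix gives degree `k`, and a
single row of the generator attains weight `2m + 1` (`exists_isMDPCode`). -/

theorem sum_eval_mul_eq_sum_coeff_mul_moment (x : ι → F) (v : ι → K) (g : F[X]) {m : ℕ}
    (hg : g.natDegree < m) :
    ∑ j, algebraMap F K (g.eval (x j)) * v j =
      ∑ i ∈ Finset.range m, algebraMap F K (g.coeff i) * ∑ j, algebraMap F K (x j) ^ i * v j := by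
  simp_rw [Finset.mul_sum]
  rw [Finset.sum_comm]
  refine Finset.sum_congr rfl fun j _ => ?_
  rw [eval_eq_sum_range' hg, map_sum, Finset.sum_mul]
  refine Finset.sum_congr rfl fun i _ => ?_
  rw [map_mul, map_pow, mul_assoc]

/-- A polynomial of degree less than `m` annihilates a vector whose first `m` moments vanish. -/
theorem sum_eval_mul_eq_zero {x : ι → F} {v : ι → K} {m : ℕ}
    (h : ∀ i < m, ∑ j, algebraMap F K (x j) ^ i * v j = 0) (g : F[X]) (hg : g.natDegree < m) :
    ∑ j, algebraMap F K (g.eval (x j)) * v j = 0 := by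
  rw [sum_eval_mul_eq_sum_coeff_mul_moment x v g hg]
  exact Finset.sum_eq_zero fun i hi => by rw [h i (Finset.mem_range.1 hi), mul_zero]

/-- If the first `m` moments of `v` vanish and fewer than `m` nodes outside `A` carry nonzero
entries, the entries of `v` on `A` satisfy a linear relation over `F` with nonzero coefficients. -/
theorem exists_linear_relation [DecidableEq ι] {x : ι → F} (hx : Function.Injective x)
    {v : ι → K} {m : ℕ} (h : ∀ i < m, ∑ j, algebraMap F K (x j) ^ i * v j = 0)
    (A S : Finset ι) (hS : ∀ j, v j ≠ 0 → j ∈ S) (hA : (S \ A).card < m) :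
    ∃ μ : ι → F, (∀ j ∈ A, μ j ≠ 0) ∧ ∑ j ∈ A, algebraMap F K (μ j) * v j = 0 := by
  -- The locator polynomial of the support outside `A` kills exactly those terms, and its degree is
  -- below `m`.
  refine ⟨fun j => (Lagrange.nodal (S \ A) x).eval (x j), fun j hj => ?_, ?_⟩
  · refine Lagrange.eval_nodal_not_at_node fun i hi hij => ?_
    rw [← hx hij] at hi
    exact (Finset.mem_sdiff.1 hi).2 hj
  · rw [← sum_eval_mul_eq_zero h (Lagrange.nodal (S \ A) x)
      (by rwa [Lagrange.natDegree_nodal])]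
    refine Finset.sum_subset (Finset.subset_univ A) fun j _ hj => ?_
    by_cases hv : v j = 0
    · rw [hv, mul_zero]
    · beta_reduce
      rw [Lagrange.eval_nodal_at_node (Finset.mem_sdiff.2 ⟨hS j hv, hj⟩), map_zero, zero_mul]

open Classical in
theorem mem_support_filter (v : ι → K) (j : ι) (hj : v j ≠ 0) :
    j ∈ (Finset.univ.filter fun i => v i ≠ 0) := by simpa using hj

open Classical in
-- The MDS property: isolating one nonzero entry `v p` leaves a relation `μ p * v p = 0` with `μ p ≠
-- 0`.
theorem eq_zero_of_hammingNorm_le {x : ι → F} (hx : Function.Injective x) {v : ι → K} {m : ℕ}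
    (h : ∀ i < m, ∑ j, algebraMap F K (x j) ^ i * v j = 0) (hv : hammingNorm v ≤ m) : v = 0 := by
  by_contra hne
  obtain ⟨p, hp⟩ := Function.ne_iff.1 hne
  obtain ⟨μ, hμ, hs⟩ := exists_linear_relation hx h {p} (Finset.univ.filter fun i => v i ≠ 0)
    (mem_support_filter v) (by
      rw [Finset.sdiff_singleton_eq_erase]
      exact (Finset.card_erase_lt_of_mem (mem_support_filter v p hp)).trans_le hv)
  rw [Finset.sum_singleton, mul_eq_zero] at hs
  rcases hs with hs | hs
  · exact hμ p (by simp) (by simpa using hs)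
  · exact hp hs

open Classical in
/-- The entries of a vector of weight at most `m + 1` whose first `m` moments vanish have
ratios in `F`. -/
theorem exists_ratio {x : ι → F} (hx : Function.Injective x) {v : ι → K} {m : ℕ}
    (h : ∀ i < m, ∑ j, algebraMap F K (x j) ^ i * v j = 0) (hv : hammingNorm v ≤ m + 1)
    {p : ι} (hp : v p ≠ 0) (l : ι) : ∃ c : F, v l = algebraMap F K c * v p := by
  by_cases hl : v l = 0
  · exact ⟨0, by simp [hl]⟩
  by_cases hpl : l = p
  · exact ⟨1, by simp [hpl]⟩
  set S := Finset.univ.filter fun i => v i ≠ 0 with hSdef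
  have hlS : l ∈ S := mem_support_filter v l hl
  have hpS : p ∈ S := mem_support_filter v p hp
  have hsub : ({l, p} : Finset ι) ⊆ S := by
    intro j hj
    rcases Finset.mem_insert.1 hj with rfl | hj
    · exact hlS
    · rwa [Finset.mem_singleton.1 hj]
  have hc := Finset.card_sdiff_of_subset hsub
  rw [Finset.card_pair hpl] at hc
  have h2 : 2 ≤ S.card := by rw [← Finset.card_pair hpl]; exact Finset.card_le_card hsub
  have hS : S.card ≤ m + 1 := hv
  obtain ⟨μ, hμ, hs⟩ := exists_linear_relation hx h {l, p} S (mem_support_filter v) (by omega)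
  rw [Finset.sum_pair hpl] at hs
  have hμl : algebraMap F K (μ l) ≠ 0 := by simpa using hμ l (by simp)
  refine ⟨-(μ p / μ l), ?_⟩
  rw [map_neg, map_div₀]
  field_simp
  linear_combination hs

open Classical in
theorem exists_relation_of_three {x : ι → F} (hx : Function.Injective x) {v : ι → K} {m : ℕ}
    (h : ∀ i < m, ∑ j, algebraMap F K (x j) ^ i * v j = 0) (hv : hammingNorm v ≤ m + 2)
    {p q r : ι} (hpq : p ≠ q) (hpr : p ≠ r) (hqr : q ≠ r) :
    ∃ a b c : F, (a ≠ 0 ∨ b ≠ 0 ∨ c ≠ 0) ∧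
      algebraMap F K a * v p + algebraMap F K b * v q + algebraMap F K c * v r = 0 := by
  by_cases hp : v p = 0
  · exact ⟨1, 0, 0, by simp, by simp [hp]⟩
  by_cases hq : v q = 0
  · exact ⟨0, 1, 0, by simp, by simp [hq]⟩
  by_cases hr : v r = 0
  · exact ⟨0, 0, 1, by simp, by simp [hr]⟩
  set S := Finset.univ.filter fun i => v i ≠ 0 with hSdef
  have hsub : ({p, q, r} : Finset ι) ⊆ S := by
    intro j hj
    simp only [Finset.mem_insert, Finset.mem_singleton] at hj
    rcases hj with rfl | rfl | rfl <;> exact mem_support_filter v _ ‹_›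
  have h3 : ({p, q, r} : Finset ι).card = 3 := Finset.card_eq_three.2 ⟨p, q, r, hpq, hpr, hqr, rfl⟩
  have hc := Finset.card_sdiff_of_subset hsub
  have h3' := Finset.card_le_card hsub
  have hS : S.card ≤ m + 2 := hv
  obtain ⟨μ, hμ, hs⟩ := exists_linear_relation hx h {p, q, r} S (mem_support_filter v) (by omega)
  refine ⟨μ p, μ q, μ r, Or.inl (hμ p (by simp)), ?_⟩
  rw [Finset.sum_insert (by simp [hpq, hpr]), Finset.sum_pair hqr] at hs
  linear_combination hs

open Classical in
/-- The moments of a vector of weight at most `e` satisfy a monic linear recurrence of order `e`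
over `F`. -/
theorem exists_moment_relation (x : ι → F) (v : ι → K) {m e : ℕ} (hv : hammingNorm v ≤ e)
    (he : e < m) : ∃ c : ℕ → F, c e = 1 ∧ (∀ i, e < i → c i = 0) ∧
      ∑ i ∈ Finset.range m, algebraMap F K (c i) * ∑ j, algebraMap F K (x j) ^ i * v j = 0 := by
  set S := Finset.univ.filter fun i => v i ≠ 0 with hSdef
  have hS : S.card ≤ e := hv
  -- The factor `X ^ (e - S.card)` pads the locator polynomial to degree exactly `e`, so the
  -- coefficient at `e` is one even when the weight is smaller.
  have hm : (Lagrange.nodal S x * X ^ (e - S.card)).Monic :=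
    (Lagrange.nodal_monic).mul (monic_X_pow _)
  have hd : (Lagrange.nodal S x * X ^ (e - S.card)).natDegree = e := by
    rw [(Lagrange.nodal_monic).natDegree_mul (monic_X_pow _), Lagrange.natDegree_nodal,
      natDegree_X_pow]
    omega
  refine ⟨(Lagrange.nodal S x * X ^ (e - S.card)).coeff, ?_, fun i hi => ?_, ?_⟩
  · have := hm.coeff_natDegree
    rwa [hd] at this
  · exact coeff_eq_zero_of_natDegree_lt (by omega)
  · rw [← sum_eval_mul_eq_sum_coeff_mul_moment x v _ (by omega)]
    refine Finset.sum_eq_zero fun j _ => ?_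
    by_cases hj : v j = 0
    · rw [hj, mul_zero]
    · rw [eval_mul, Lagrange.eval_nodal_at_node (mem_support_filter v j hj), zero_mul, map_zero,
        zero_mul]

open Classical in
theorem hammingNorm_le_of_eq_zero_on (v : ι → K) (A : Finset ι) (hA : ∀ j ∈ A, v j = 0) :
    hammingNorm v ≤ Fintype.card ι - A.card := by
  rw [← Finset.card_compl]
  refine Finset.card_le_card fun j hj => ?_
  rw [Finset.mem_compl]
  exact fun h => (Finset.mem_filter.1 hj).2 (hA j h)

/-! ### The weight bounds for truncated codewords -/

open Classical in
-- Here `m = M + 2`. If `wt v = m + 1`, then `v q / v p` lies in `F` and the recurrence for `w`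
-- makes `β₁, β₂` dependent. If `wt v = m + 2`, then `wt w ≤ M` and two recurrences give `v p = v q
-- = 0`.
theorem weight_bound_two {x : ι → F} (hx : Function.Injective x) {M : ℕ}
    (hcard : Fintype.card ι = M + 4) {p q : ι} (hpq : p ≠ q) {β₁ β₂ : K}
    (hβ : LinearIndependent F ![β₁, β₂]) {v w : ι → K} (hv : v ≠ 0)
    (h0 : ∀ i < M + 2, ∑ j, algebraMap F K (x j) ^ i * v j = 0)
    (h1 : ∀ i < M, ∑ j, algebraMap F K (x j) ^ i * w j = 0)
    (h2 : ∑ j, algebraMap F K (x j) ^ M * w j = -(β₁ * v p))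
    (h3 : ∑ j, algebraMap F K (x j) ^ (M + 1) * w j = -(β₂ * v p + β₁ * v q)) :
    2 * (M + 2) + 1 ≤ hammingNorm v + hammingNorm w := by
  have hβ₁ : β₁ ≠ 0 := hβ.ne_zero 0
  -- Two zero entries leave weight at most `M + 2`, the number of vanishing moments.
  have hne : v p = 0 → v q = 0 → False := fun hp hq => hv <| by
    refine eq_zero_of_hammingNorm_le hx h0 ?_
    have := hammingNorm_le_of_eq_zero_on v {p, q} (by simp [hp, hq])
    rw [Finset.card_pair hpq, hcard] at this
    omega
  by_contra! hlt
  have hv1 : M + 3 ≤ hammingNorm v := by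
    by_contra! h
    exact hv (eq_zero_of_hammingNorm_le hx h0 (by omega))
  have rel : ∀ c : ℕ → F, ∑ i ∈ Finset.range (M + 2), algebraMap F K (c i) *
      ∑ j, algebraMap F K (x j) ^ i * w j =
      -(algebraMap F K (c M) * (β₁ * v p) + algebraMap F K (c (M + 1)) *
        (β₂ * v p + β₁ * v q)) := fun c => by
    rw [Finset.sum_range_succ, Finset.sum_range_succ, Finset.sum_eq_zero, h2, h3]
    · ring
    · exact fun i hi => by rw [h1 i (Finset.mem_range.1 hi), mul_zero]
  obtain ⟨c, hc1, -, hc⟩ := exists_moment_relation x w (m := M + 2) (e := M + 1)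
    (by omega) (by omega)
  rw [rel, hc1, map_one] at hc
  by_cases hs : hammingNorm v ≤ M + 3
  · by_cases hp : v p = 0
    · simp only [hp, mul_zero, zero_add, one_mul, neg_eq_zero, mul_eq_zero, hβ₁, false_or] at hc
      exact hne hp hc
    obtain ⟨b, hb⟩ := exists_ratio hx h0 hs hp q
    rw [hb] at hc
    have hc' : (algebraMap F K (c M + b) * β₁ + algebraMap F K 1 * β₂) * v p = 0 := by
      rw [map_add, map_one]
      linear_combination -hc
    have := LinearIndependent.pair_iff.1 hβ (c M + b) 1 (by
      simpa [Algebra.smul_def, hp] using hc')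
    exact one_ne_zero this.2
  · obtain ⟨d, hd1, hd2, hd⟩ := exists_moment_relation x w (m := M + 2) (e := M)
      (by omega) (by omega)
    rw [rel, hd1, hd2 _ (by omega)] at hd
    have hp : v p = 0 := by simpa [hβ₁] using hd
    simp only [hp, mul_zero, zero_add, one_mul, neg_eq_zero, mul_eq_zero, hβ₁, false_or] at hc
    exact hne hp hc

/-- An element of degree three over `F` satisfies no nontrivial quadratic equation. -/
theorem quadratic_coeff_eq_zero {a : K} (ha : (minpoly F a).natDegree = 3) {c₀ c₁ c₂ : F}
    (h : algebraMap F K c₂ * a ^ 2 + algebraMap F K c₁ * a + algebraMap F K c₀ = 0) :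
    c₀ = 0 ∧ c₁ = 0 ∧ c₂ = 0 := by
  have h0 : (C c₂ * X ^ 2 + C c₁ * X + C c₀ : F[X]) = 0 := by
    by_contra hne
    have := natDegree_le_of_dvd (minpoly.dvd F a (p := C c₂ * X ^ 2 + C c₁ * X + C c₀)
      (by simpa using h)) hne
    have := natDegree_quadratic_le (a := c₂) (b := c₁) (c := c₀)
    omega
  refine ⟨?_, ?_, ?_⟩
  · simpa using congrArg (fun f => coeff f 0) h0
  · simpa [coeff_X, coeff_C] using congrArg (fun f => coeff f 1) h0
  · simpa [coeff_X, coeff_C] using congrArg (fun f => coeff f 2) h0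

/-- A monic cubic annihilating an element of degree three is its minimal polynomial. -/
theorem minpoly_coeff_zero_of_cubic {a : K} (ha : (minpoly F a).natDegree = 3) {c₀ c₁ c₂ : F}
    (h : a ^ 3 + algebraMap F K c₂ * a ^ 2 + algebraMap F K c₁ * a + algebraMap F K c₀ = 0) :
    (minpoly F a).coeff 0 = c₀ := by
  have hi : IsIntegral F a := by
    by_contra hi
    rw [minpoly.eq_zero hi] at ha
    simp at ha
  have hd : (X ^ 3 + (C c₂ * X ^ 2 + C c₁ * X + C c₀) : F[X]).natDegree = 3 := by compute_degree!
  have hm : (X ^ 3 + (C c₂ * X ^ 2 + C c₁ * X + C c₀) : F[X]).Monic := by monicity!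
  have := eq_of_monic_of_dvd_of_natDegree_le (minpoly.monic hi) hm
    (minpoly.dvd F a (by simpa [add_assoc] using h)) (by omega)
  rw [← this]
  simp

open Classical in
-- Here `m = M + 3`, and each extra unit of weight in `v` buys a shorter recurrence for `w`. The
-- critical case is `wt v = m + 2`: an `F`-relation among `v p, v q, v r` becomes a cubic equation
-- for `a` with constant coefficient `-1`, because `β₃ = 1`.
theorem weight_bound_three {x : ι → F} (hx : Function.Injective x) {M : ℕ}
    (hcard : Fintype.card ι = M + 6) {p q r : ι} (hpq : p ≠ q) (hpr : p ≠ r) (hqr : q ≠ r)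
    {a : K} (ha : (minpoly F a).natDegree = 3) (ha1 : (minpoly F a).coeff 0 ≠ -1)
    {v w : ι → K} (hv : v ≠ 0)
    (h0 : ∀ i < M + 3, ∑ j, algebraMap F K (x j) ^ i * v j = 0)
    (h1 : ∀ i < M, ∑ j, algebraMap F K (x j) ^ i * w j = 0)
    (h2 : ∑ j, algebraMap F K (x j) ^ M * w j = -(a * v p))
    (h3 : ∑ j, algebraMap F K (x j) ^ (M + 1) * w j = -(a ^ 2 * v p + a * v q))
    (h4 : ∑ j, algebraMap F K (x j) ^ (M + 2) * w j = -(v p + a ^ 2 * v q + a * v r)) :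
    2 * (M + 3) + 1 ≤ hammingNorm v + hammingNorm w := by
  have ha0 : a ≠ 0 := by
    rintro rfl
    rw [minpoly.zero] at ha
    simp at ha
  have hne : v p = 0 → v q = 0 → v r = 0 → False := fun hp hq hr => hv <| by
    refine eq_zero_of_hammingNorm_le hx h0 ?_
    have := hammingNorm_le_of_eq_zero_on v {p, q, r} (by simp [hp, hq, hr])
    rw [Finset.card_eq_three.2 ⟨p, q, r, hpq, hpr, hqr, rfl⟩, hcard] at this
    omega
  by_contra! hlt
  have hv1 : M + 4 ≤ hammingNorm v := by
    by_contra! h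
    exact hv (eq_zero_of_hammingNorm_le hx h0 (by omega))
  have rel : ∀ c : ℕ → F, ∑ i ∈ Finset.range (M + 3), algebraMap F K (c i) *
      ∑ j, algebraMap F K (x j) ^ i * w j =
      -(algebraMap F K (c M) * (a * v p) + algebraMap F K (c (M + 1)) *
        (a ^ 2 * v p + a * v q) + algebraMap F K (c (M + 2)) *
        (v p + a ^ 2 * v q + a * v r)) := fun c => by
    rw [Finset.sum_range_succ, Finset.sum_range_succ, Finset.sum_range_succ, Finset.sum_eq_zero,
      h2, h3, h4]
    · ring
    · exact fun i hi => by rw [h1 i (Finset.mem_range.1 hi), mul_zero]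
  obtain ⟨c, hc1, -, hc⟩ := exists_moment_relation x w (m := M + 3) (e := M + 2)
    (by omega) (by omega)
  rw [rel, hc1, map_one] at hc
  by_cases hs : hammingNorm v ≤ M + 4
  -- With all entries in `F` up to a common scale `s`, the recurrence is a quadratic equation for
  -- `a`; its coefficients are triangular in `b₀, b₁, b₂`.
  · have key : ∀ s : K, s ≠ 0 → ∀ b₀ b₁ b₂ : F, v p = algebraMap F K b₀ * s →
        v q = algebraMap F K b₁ * s → v r = algebraMap F K b₂ * s → False := by
      intro s hs0 b₀ b₁ b₂ e₀ e₁ e₂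
      have e : (algebraMap F K (b₁ + c (M + 1) * b₀) * a ^ 2 +
          algebraMap F K (b₂ + c (M + 1) * b₁ + c M * b₀) * a + algebraMap F K b₀) * s = 0 := by
        rw [e₀, e₁, e₂] at hc
        simp only [map_add, map_mul]
        linear_combination -hc
      obtain ⟨z₀, z₁, z₂⟩ :=
        quadratic_coeff_eq_zero ha ((mul_eq_zero.1 e).resolve_right hs0)
      have z₃ : b₁ = 0 := by simpa [z₀] using z₂
      have z₄ : b₂ = 0 := by simpa [z₀, z₃] using z₁
      exact hne (by simp [e₀, z₀]) (by simp [e₁, z₃]) (by simp [e₂, z₄])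
    have key' : ∀ l, v l ≠ 0 → False := fun l hl => by
      obtain ⟨b₀, e₀⟩ := exists_ratio hx h0 hs hl p
      obtain ⟨b₁, e₁⟩ := exists_ratio hx h0 hs hl q
      obtain ⟨b₂, e₂⟩ := exists_ratio hx h0 hs hl r
      exact key _ hl b₀ b₁ b₂ e₀ e₁ e₂
    exact hv (funext fun l => not_not.1 (key' l))
  obtain ⟨d, hd1, hd2, hd⟩ := exists_moment_relation x w (m := M + 3) (e := M + 1)
    (by omega) (by omega)
  rw [rel, hd1, hd2 (M + 2) (by omega), map_one, map_zero] at hd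
  have hp : v p ≠ 0 := fun hp => by
    have hq : v q = 0 := by simpa [hp, ha0] using hd
    have hr : v r = 0 := by simpa [hp, hq, ha0] using hc
    exact hne hp hq hr
  by_cases hs' : hammingNorm v ≤ M + 5
  · obtain ⟨b₀, b₁, b₂, hb, e⟩ := exists_relation_of_three hx h0 hs' hpq hpr hqr
    -- The recurrences of orders `M + 1` and `M + 2` express `v q` and `a * v r` through `v p`.
    -- Substituting into `a` times the relation `e` leaves a polynomial in `a` of degree at most
    -- three.
    have e1 : v q = -(a + algebraMap F K (d M)) * v p :=
      mul_left_cancel₀ ha0 (by linear_combination -hd)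
    have e2 : a * v r = (a ^ 3 + algebraMap F K (d M) * a ^ 2
        + algebraMap F K (c (M + 1) * d M - c M) * a - 1) * v p := by
      rw [e1] at hc
      simp only [map_sub, map_mul]
      linear_combination -hc
    have e3 : (algebraMap F K b₂ * (a ^ 3 + algebraMap F K (d M) * a ^ 2
        + algebraMap F K (c (M + 1) * d M - c M) * a - 1)
        - algebraMap F K b₁ * (a ^ 2 + algebraMap F K (d M) * a) + algebraMap F K b₀ * a) * v p
        = 0 := by
      rw [e1] at e
      linear_combination a * e - algebraMap F K b₂ * e2
    have e4 := (mul_eq_zero.1 e3).resolve_right hp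
    by_cases hb2 : b₂ = 0
    · have := quadratic_coeff_eq_zero ha (c₀ := 0) (c₁ := b₀ - b₁ * d M) (c₂ := -b₁) (by
        simp only [hb2, map_sub, map_mul, map_neg, map_zero] at e4 ⊢
        linear_combination e4)
      obtain ⟨-, z₁, z₂⟩ := this
      have z₃ : b₁ = 0 := by simpa using z₂
      have z₄ : b₀ = 0 := by simpa [z₃] using z₁
      simp [hb2, z₃, z₄] at hb
    · have hb2' : algebraMap F K b₂ ≠ 0 := by simpa using hb2
      refine ha1 (minpoly_coeff_zero_of_cubic ha (c₀ := -1) (c₂ := d M - b₁ / b₂)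
        (c₁ := c (M + 1) * d M - c M - b₁ / b₂ * d M + b₀ / b₂) ?_)
      refine mul_left_cancel₀ hb2' ?_
      simp only [map_sub, map_mul, map_neg, map_one, map_add, map_div₀] at e4 ⊢
      field_simp
      linear_combination e4
  -- Now `wt w ≤ M`, so the recurrence of order `M` involves only the moment `-(a * v p)`.
  · obtain ⟨d, hd1, hd2, hd⟩ := exists_moment_relation x w (m := M + 3) (e := M)
      (by omega) (by omega)
    rw [rel, hd1, hd2 (M + 1) (by omega), hd2 (M + 2) (by omega)] at hd
    exact hp (by simpa [ha0] using hd)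

end Moments

/-! ### Systematic generators, the degree, and the column distance -/

section Codes

variable {K : Type*} [Field K]

/-- A matrix with linearly independent rows has a nonzero maximal minor. -/
theorem exists_orderEmb_det_submatrix_ne_zero {k n : ℕ} (A : Matrix (Fin k) (Fin n) K)
    (hA : LinearIndependent K A.row) : ∃ f : Fin k ↪o Fin n, (A.submatrix id f).det ≠ 0 := by
  classical
  -- A column basis has `k` elements because row rank equals column rank; listing its indices in
  -- increasing order gives the embedding.
  obtain ⟨κ, a, ha, hspan, hli⟩ := exists_linearIndependent' K A.col
  have : Fintype κ := Fintype.ofInjective a ha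
  have hcard : (Finset.univ.image a).card = k := by
    rw [Finset.card_image_of_injective _ ha, Finset.card_univ, ← finrank_span_eq_card hli, hspan,
      ← Matrix.rank_eq_finrank_span_cols, hA.rank_matrix, Fintype.card_fin]
  let f := (Finset.univ.image a).orderEmbOfFin hcard
  choose g hg using fun i =>
    Finset.mem_image.1 (Finset.orderEmbOfFin_mem (Finset.univ.image a) hcard i)
  have hfg : A.col ∘ f = (A.col ∘ a) ∘ g := funext fun i => congrArg A.col (hg i).2.symm
  have hginj : Function.Injective g := fun i j hij => f.injective (by
    change (Finset.univ.image a).orderEmbOfFin hcard i = (Finset.univ.image a).orderEmbOfFin hcard j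
    rw [← (hg i).2, ← (hg j).2, hij])
  refine ⟨f, ?_⟩
  have hcol : LinearIndependent K (A.submatrix id f).col := by
    have := hli.comp g hginj
    rw [← hfg] at this
    exact this
  exact ((Matrix.isUnit_iff_isUnit_det _).1
    (Matrix.linearIndependent_cols_iff_isUnit.1 hcol)).ne_zero

theorem polyMatrix_mulVec_coeff {m n : ℕ} {H₀ H₁ : Matrix (Fin m) (Fin n) K} {v : Fin n → K[X]}
    (h : (polyMatrix H₀ H₁).mulVec v = 0) :
    H₀.mulVec (fun i => (v i).coeff 0) = 0 ∧
      H₀.mulVec (fun i => (v i).coeff 1) + H₁.mulVec (fun i => (v i).coeff 0) = 0 := by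
  refine ⟨funext fun i => ?_, funext fun i => ?_⟩
  · simpa [polyMatrix, Matrix.mulVec, dotProduct, finsetSum_coeff, add_mul, mul_assoc] using
      congrArg (fun p => coeff p 0) (congrFun h i)
  · simpa [polyMatrix, Matrix.mulVec, dotProduct, finsetSum_coeff, add_mul, mul_assoc,
      Finset.sum_add_distrib, coeff_X_mul] using congrArg (fun p => coeff p 1) (congrFun h i)

/-- The generator matrix of the kernel of `[A + E z | B]`, where `P = B⁻¹ A` and `R = B⁻¹ E`. -/
noncomputable def kernelGenerator {k m : ℕ} (P R : Matrix (Fin m) (Fin k) K) :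
    Matrix (Fin k) (Fin (k + m)) K[X] :=
  (X : K[X]) • (Matrix.of fun a => Fin.append 0 fun j => -R j a).map C +
    (Matrix.of fun a => Fin.append (Pi.single a 1) fun j => -P j a).map C

section KernelGenerator

variable {k m : ℕ} (P R : Matrix (Fin m) (Fin k) K)

theorem kernelGenerator_castAdd (a b : Fin k) :
    kernelGenerator P R a (Fin.castAdd m b) = (1 : Matrix (Fin k) (Fin k) K[X]) a b := by
  by_cases h : a = b <;> simp [kernelGenerator, Matrix.one_apply, h, eq_comm]

theorem kernelGenerator_natAdd (a : Fin k) (j : Fin m) :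
    kernelGenerator P R a (Fin.natAdd k j) = -(C (P j a) + X * C (R j a)) := by
  simp [kernelGenerator]

theorem vecMul_kernelGenerator_castAdd (u : Fin k → K[X]) (b : Fin k) :
    Matrix.vecMul u (kernelGenerator P R) (Fin.castAdd m b) = u b := by
  simp [Matrix.vecMul, dotProduct, kernelGenerator_castAdd, Matrix.one_apply]

theorem linearIndependent_kernelGenerator :
    LinearIndependent K[X] (kernelGenerator P R).row := by
  rw [← Matrix.vecMul_injective_iff]
  intro u w h
  funext b
  rw [← vecMul_kernelGenerator_castAdd P R u b, ← vecMul_kernelGenerator_castAdd P R w b]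
  exact congrFun h _

/-- The coefficient of `X ^ k` in a maximal minor is the corresponding minor of `[0 | -Rᵀ]`, which
has full row rank when `R` is injective. -/
theorem isGreatest_natDegree_minors (hR : Function.Injective R.mulVec) :
    IsGreatest {d : ℕ | ∃ f : Fin k ↪o Fin (k + m),
      d = ((kernelGenerator P R).submatrix id f).det.natDegree} k := by
  set G₁ : Matrix (Fin k) (Fin (k + m)) K :=
    Matrix.of fun a => Fin.append 0 fun j => -R j a with hG₁
  set G₀ : Matrix (Fin k) (Fin (k + m)) K :=
    Matrix.of fun a => Fin.append (Pi.single a 1) fun j => -P j a with hG₀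
  have hsub : ∀ f : Fin k ↪o Fin (k + m), (kernelGenerator P R).submatrix id f =
      (X : K[X]) • (G₁.submatrix id f).map C + (G₀.submatrix id f).map C := fun f => rfl
  have hle : ∀ f : Fin k ↪o Fin (k + m),
      ((kernelGenerator P R).submatrix id f).det.natDegree ≤ k := fun f => by
    rw [hsub]
    simpa using natDegree_det_X_add_C_le (G₁.submatrix id f) (G₀.submatrix id f)
  refine ⟨?_, fun d ⟨f, hf⟩ => hf ▸ hle f⟩
  have hli : LinearIndependent K G₁.row := by
    rw [← Matrix.vecMul_injective_iff]
    intro u w h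
    refine hR (funext fun j => ?_)
    have := congrFun h (Fin.natAdd k j)
    simpa [Matrix.vecMul, Matrix.mulVec, dotProduct, hG₁, mul_comm] using this
  obtain ⟨f, hf⟩ := exists_orderEmb_det_submatrix_ne_zero G₁ hli
  refine ⟨f, le_antisymm (le_natDegree_of_ne_zero ?_) (hle f)⟩
  have := coeff_det_X_add_C_card (G₁.submatrix id f) (G₀.submatrix id f)
  rw [Fintype.card_fin] at this
  rwa [hsub, this]

open Classical in
theorem hammingNorm_kernelGenerator_coeff_zero (a : Fin k) :
    hammingNorm (fun i => (kernelGenerator P R a i).coeff 0) ≤ m + 1 := by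
  simp only [hammingNorm, Finset.card_filter]
  rw [Fin.sum_univ_add, add_comm m 1]
  refine add_le_add ?_ ?_
  · rw [Finset.sum_eq_single a]
    · split_ifs <;> simp
    · intro b _ hb
      simp [kernelGenerator_castAdd, Matrix.one_apply_ne' hb]
    · simp
  · refine (Finset.sum_le_card_nsmul _ _ 1 fun j _ => ?_).trans (by simp)
    split_ifs <;> simp

open Classical in
theorem hammingNorm_kernelGenerator_coeff_one (a : Fin k) :
    hammingNorm (fun i => (kernelGenerator P R a i).coeff 1) ≤ m := by
  simp only [hammingNorm, Finset.card_filter]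
  rw [Fin.sum_univ_add, Finset.sum_eq_zero, zero_add]
  · refine (Finset.sum_le_card_nsmul _ _ 1 fun j _ => ?_).trans (by simp)
    split_ifs <;> simp
  · intro b _
    by_cases h : a = b <;> simp [kernelGenerator_castAdd, h, coeff_one]

end KernelGenerator

section ParityCheck

variable {k m : ℕ} {H₀ H₁ : Matrix (Fin m) (Fin (k + m)) K}

/-- If the last `m` columns of `H₀ + H₁ z` form a constant invertible matrix, the kernel is
generated by the rows of `kernelGenerator`. -/
theorem polyMatrix_mulVec_eq_zero_iff (hB : IsUnit (H₀.submatrix id (Fin.natAdd k)))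
    (h₁ : ∀ i j, H₁ i (Fin.natAdd k j) = 0) (v : Fin (k + m) → K[X]) :
    (polyMatrix H₀ H₁).mulVec v = 0 ↔ ∃ u, v = Matrix.vecMul u (kernelGenerator
      ((H₀.submatrix id (Fin.natAdd k))⁻¹ * H₀.submatrix id (Fin.castAdd m))
      ((H₀.submatrix id (Fin.natAdd k))⁻¹ * H₁.submatrix id (Fin.castAdd m))) := by
  set B := H₀.submatrix id (Fin.natAdd k) with hBdef
  set P := B⁻¹ * H₀.submatrix id (Fin.castAdd m) with hP
  set R := B⁻¹ * H₁.submatrix id (Fin.castAdd m) with hR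
  have hdet : IsUnit B.det := (Matrix.isUnit_iff_isUnit_det B).1 hB
  have hBP : B * P = H₀.submatrix id (Fin.castAdd m) := Matrix.mul_nonsing_inv_cancel_left B _ hdet
  have hBR : B * R = H₁.submatrix id (Fin.castAdd m) := Matrix.mul_nonsing_inv_cancel_left B _ hdet
  have hHG : polyMatrix H₀ H₁ * (kernelGenerator P R).transpose = 0 := by
    ext1 i a
    have e₀ : ∑ j, C (B i j) * C (P j a) = C (H₀ i (Fin.castAdd m a)) := by
      simp only [← C_mul, ← map_sum]
      exact congrArg C (congrFun (congrFun hBP i) a)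
    have e₁ : ∑ j, C (B i j) * C (R j a) = C (H₁ i (Fin.castAdd m a)) := by
      simp only [← C_mul, ← map_sum]
      exact congrArg C (congrFun (congrFun hBR i) a)
    have e₂ : ∑ j, C (B i j) * -(C (P j a) + X * C (R j a)) =
        -(∑ j, C (B i j) * C (P j a) + X * ∑ j, C (B i j) * C (R j a)) := by
      rw [Finset.mul_sum, ← Finset.sum_add_distrib, ← Finset.sum_neg_distrib]
      exact Finset.sum_congr rfl fun j _ => by ring
    rw [Matrix.mul_apply, Fin.sum_univ_add]
    have e₃ : ∀ j, polyMatrix H₀ H₁ i (Fin.natAdd k j) = C (B i j) := fun j => by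
      simp [polyMatrix, h₁, hBdef]
    simp only [Matrix.transpose_apply, kernelGenerator_castAdd, kernelGenerator_natAdd, e₃, e₂, e₀,
      e₁]
    simp [Matrix.one_apply, polyMatrix]
  have hGu : ∀ u, (polyMatrix H₀ H₁).mulVec (Matrix.vecMul u (kernelGenerator P R)) = 0 := by
    intro u
    rw [← Matrix.mulVec_transpose, Matrix.mulVec_mulVec, hHG, Matrix.zero_mulVec]
  constructor
  · intro hv
    refine ⟨fun b => v (Fin.castAdd m b), ?_⟩
    set u : Fin k → K[X] := fun b => v (Fin.castAdd m b) with hu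
    -- Subtracting the codeword with the same first `k` entries leaves a kernel vector supported on
    -- the last `m` coordinates, where `H` is the invertible constant matrix `B`.
    set d := v - Matrix.vecMul u (kernelGenerator P R) with hd
    have hd0 : ∀ b, d (Fin.castAdd m b) = 0 := fun b => by
      rw [hd, Pi.sub_apply, vecMul_kernelGenerator_castAdd, hu, sub_self]
    have hHd : (polyMatrix H₀ H₁).mulVec d = 0 := by
      rw [hd, Matrix.mulVec_sub, hv, hGu, sub_zero]
    have hBd : (B.map C).mulVec (fun j => d (Fin.natAdd k j)) = 0 := by
      rw [← hHd]
      funext i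
      simp [Matrix.mulVec, dotProduct, Fin.sum_univ_add, hd0, polyMatrix, h₁, hBdef]
    have hinj : Function.Injective (B.map C).mulVec :=
      Matrix.mulVec_injective_of_isUnit (hB.map (C : K →+* K[X]).mapMatrix)
    have hd1 := hinj (hBd.trans (Matrix.mulVec_zero _).symm)
    rw [← sub_eq_zero]
    funext j
    refine Fin.addCases (fun b => hd0 b) (fun j => congrFun hd1 j) j
  · rintro ⟨u, rfl⟩
    exact hGu u

theorem linearIndependent_polyMatrix_row (hB : IsUnit (H₀.submatrix id (Fin.natAdd k)))
    (h₁ : ∀ i j, H₁ i (Fin.natAdd k j) = 0) :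
    LinearIndependent K[X] (polyMatrix H₀ H₁).row := by
  rw [← Matrix.vecMul_injective_iff]
  intro u w h
  refine Matrix.vecMul_injective_of_isUnit (hB.map (C : K →+* K[X]).mapMatrix) (funext fun j => ?_)
  simpa [Matrix.vecMul, dotProduct, polyMatrix, h₁] using congrFun h (Fin.natAdd k j)

end ParityCheck

open Classical in
/-- A sliding parity-check matrix `H₀ + H₁ z` whose last `n - k` columns are constant and
independent, whose first `k` columns have independent `z`-coefficients, and whose truncated
codewords have the maximal possible weight, defines an MDP code. -/
theorem exists_isMDPCode {n m k : ℕ} (hn : n = k + m) (hk : 0 < k) (hkm : k < m)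
    {H₀ H₁ : Matrix (Fin m) (Fin n) K}
    (hB : ∀ v : Fin n → K, (∀ j : Fin n, (j : ℕ) < k → v j = 0) → H₀.mulVec v = 0 → v = 0)
    (h₁ : ∀ i (j : Fin n), k ≤ (j : ℕ) → H₁ i j = 0)
    (hE : ∀ v : Fin n → K, H₁.mulVec v = 0 → ∀ j : Fin n, (j : ℕ) < k → v j = 0)
    (hw : ∀ v w : Fin n → K, v ≠ 0 → H₀.mulVec v = 0 → H₀.mulVec w + H₁.mulVec v = 0 →
      2 * m + 1 ≤ hammingNorm v + hammingNorm w) :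
    ∃ 𝒞 : Submodule K[X] (Fin n → K[X]), IsMDPCode 𝒞 k k ∧
      IsParityCheckMatrix (polyMatrix H₀ H₁) 𝒞 := by
  subst hn
  have h₁' : ∀ i j, H₁ i (Fin.natAdd k j) = 0 := fun i j => h₁ i _ (by simp)
  have hB' : IsUnit (H₀.submatrix id (Fin.natAdd k)) := by
    rw [← Matrix.mulVec_injective_iff_isUnit]
    refine (injective_iff_map_eq_zero
      (Matrix.mulVecLin (H₀.submatrix id (Fin.natAdd k)))).2 fun u hu => ?_
    have := hB (Fin.append 0 u) (fun j => by
      refine Fin.addCases (fun b _ => by simp) (fun b hb => ?_) j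
      simp at hb) (by
      rw [← hu]
      funext i
      simp [Matrix.mulVec, dotProduct, Fin.sum_univ_add])
    funext j
    simpa using congrFun this (Fin.natAdd k j)
  set B := H₀.submatrix id (Fin.natAdd k) with hBdef
  set P := B⁻¹ * H₀.submatrix id (Fin.castAdd m) with hP
  set R := B⁻¹ * H₁.submatrix id (Fin.castAdd m) with hR
  have hdet : IsUnit B.det := (Matrix.isUnit_iff_isUnit_det B).1 hB'
  have hRinj : Function.Injective R.mulVec := by
    refine (injective_iff_map_eq_zero R.mulVecLin).2 fun u hu => ?_
    rw [Matrix.mulVecLin_apply] at hu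
    have hEu : (H₁.submatrix id (Fin.castAdd m)).mulVec u = 0 := by
      rw [← Matrix.mul_nonsing_inv_cancel_left B (H₁.submatrix id (Fin.castAdd m)) hdet, ← hR,
        ← Matrix.mulVec_mulVec, hu, Matrix.mulVec_zero]
    have := hE (Fin.append u 0) (by
      refine Eq.trans (funext fun i => ?_) hEu
      simp [Matrix.mulVec, dotProduct, Fin.sum_univ_add])
    funext b
    simpa using this (Fin.castAdd m b) (by simp)
  set G := kernelGenerator P R with hG
  have hmem : ∀ v : Fin (k + m) → K[X], v ∈ Submodule.span K[X] (Set.range G.row) ↔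
      ∃ u, v = Matrix.vecMul u G := fun v => by
    rw [Submodule.mem_span_range_iff_exists_fun]
    simp only [Matrix.vecMul_eq_sum, eq_comm]
    rfl
  have hker : ∀ v : Fin (k + m) → K[X], v ∈ Submodule.span K[X] (Set.range G.row) ↔
      (polyMatrix H₀ H₁).mulVec v = 0 := fun v => by
    rw [hmem, polyMatrix_mulVec_eq_zero_iff hB' h₁' v]
  have hrank : Module.finrank K[X] (Submodule.span K[X] (Set.range G.row)) = k := by
    rw [finrank_span_eq_card (linearIndependent_kernelGenerator P R), Fintype.card_fin]
  refine ⟨Submodule.span K[X] (Set.range G.row), ⟨⟨hrank, G,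
    ⟨linearIndependent_kernelGenerator P R, hmem⟩, isGreatest_natDegree_minors P R hRinj⟩, ?_⟩,
    by rw [hrank]; omega, linearIndependent_polyMatrix_row hB' h₁', hker⟩
  have hmk : k + m - k = m := by omega
  -- Here `L = 1 + 0`, since `k < m`.
  rw [Nat.div_self hk, hmk, Nat.div_eq_of_lt hkm]
  set a : Fin k := ⟨0, hk⟩
  have hGa : G a ∈ Submodule.span K[X] (Set.range G.row) := Submodule.subset_span ⟨a, rfl⟩
  have hGa0 : (fun i => (G a i).coeff 0) ≠ 0 := fun h => by
    have := congrFun h (Fin.castAdd m a)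
    simp [hG, kernelGenerator_castAdd] at this
  -- One generator row has weight at most `(m + 1) + m`, which gives the upper bound; `hw` gives the
  -- lower bound.
  refine le_antisymm (le_trans (Nat.sInf_le ⟨G a, hGa, hGa0, rfl⟩) ?_) (le_csInf
    ⟨_, G a, hGa, hGa0, rfl⟩ ?_)
  · rw [Finset.sum_range_succ, Finset.sum_range_one]
    have e₀ := hammingNorm_kernelGenerator_coeff_zero P R a
    have e₁ := hammingNorm_kernelGenerator_coeff_one P R a
    rw [← hG] at e₀ e₁
    simp only [add_zero]
    omega
  · rintro w ⟨v, hv, hv0, rfl⟩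
    obtain ⟨e₀, e₁⟩ := polyMatrix_mulVec_coeff ((hker v).1 hv)
    have := hw _ _ hv0 e₀ e₁
    rw [Finset.sum_range_succ, Finset.sum_range_one]
    simp only [add_zero]
    omega

end Codes

/-! ### The Toeplitz and Vandermonde blocks -/

section Toeplitz

variable {K : Type*} [Field K]

theorem padZeroCols_mulVec {m k n : ℕ} (h : k ≤ n) (A : Matrix (Fin m) (Fin k) K)
    (v : Fin n → K) : (padZeroCols n A).mulVec v = A.mulVec fun b => v (Fin.castLE h b) := by
  funext i
  refine (Fintype.sum_of_injective (Fin.castLE h) (Fin.castLE_injective h) _ _ (fun j hj => ?_)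
    fun b => ?_).symm
  · have : ¬ (j : ℕ) < k := fun hlt => hj ⟨⟨j, hlt⟩, rfl⟩
    simp [padZeroCols, this]
  · simp [padZeroCols]

theorem xHat_mulVec_of_lt {m k : ℕ} (β u : Fin k → K) {i : Fin m} (hi : (i : ℕ) < m - k) :
    (xHat m β).mulVec u i = 0 := by
  rw [Matrix.mulVec, dotProduct]
  refine Finset.sum_eq_zero fun j _ => ?_
  rw [xHat, Matrix.of_apply, if_neg (not_le.2 hi), zero_mul]

theorem xHat_mulVec_add {m k : ℕ} (β u : Fin k → K) {i : Fin m} (r : Fin k)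
    (hi : (i : ℕ) = m - k + r) :
    (xHat m β).mulVec u i = (toeplitzT β).mulVec u r := by
  have hr : (i : ℕ) - (m - k) = r := by omega
  have hrk : (i : ℕ) - (m - k) < k := hr ▸ r.2
  have hf : (⟨(i : ℕ) - (m - k), hrk⟩ : Fin k) = r := Fin.ext hr
  rw [Matrix.mulVec, Matrix.mulVec, dotProduct, dotProduct]
  refine Finset.sum_congr rfl fun j _ => ?_
  rw [xHat, Matrix.of_apply, if_pos (by omega), dif_pos hrk, hf]

end Toeplitz

section Vandermonde

variable {F K : Type*} [Field F] [Field K] [Algebra F K] {m n : ℕ}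

theorem vandermonde_map_mulVec (x : Fin n → F) (v : Fin n → K) (i : Fin m) :
    ((Matrix.of fun (i : Fin m) (j : Fin n) => x j ^ (i : ℕ)).map (algebraMap F K)).mulVec v i =
      ∑ j, algebraMap F K (x j) ^ (i : ℕ) * v j := by
  simp [Matrix.mulVec, dotProduct]

theorem moments_eq_zero {x : Fin n → F} {v : Fin n → K}
    (h : ((Matrix.of fun (i : Fin m) (j : Fin n) => x j ^ (i : ℕ)).map (algebraMap F K)).mulVec v
      = 0) : ∀ i < m, ∑ j, algebraMap F K (x j) ^ i * v j = 0 := fun i hi => by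
  have := congrFun h ⟨i, hi⟩
  rwa [vandermonde_map_mulVec] at this

theorem eq_zero_of_vandermonde_mulVec_eq_zero {x : Fin n → F} (hx : Function.Injective x) {k : ℕ}
    (hn : n = k + m) {v : Fin n → K} (hv : ∀ j : Fin n, (j : ℕ) < k → v j = 0)
    (h : ((Matrix.of fun (i : Fin m) (j : Fin n) => x j ^ (i : ℕ)).map (algebraMap F K)).mulVec v
      = 0) : v = 0 := by
  refine eq_zero_of_hammingNorm_le hx (moments_eq_zero h)
    ((hammingNorm_le_of_eq_zero_on v (Finset.univ.map (Fin.castLEEmb (by omega : k ≤ n)))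
      (fun j hj => ?_)).trans ?_)
  · obtain ⟨b, -, rfl⟩ := Finset.mem_map.1 hj
    exact hv _ (by simp)
  · simp only [Finset.card_map, Finset.card_univ, Fintype.card_fin]
    omega

end Vandermonde

open Classical in
-- Reduces the MDP property to injectivity of the Toeplitz matrix and a weight bound stated purely
-- in moments, the form in which the cases `k = 2` and `k = 3` are settled.
theorem exists_isMDPCode_toeplitz {F K : Type*} [Field F] [Field K] [Algebra F K] {n k : ℕ}
    (hk : 0 < k) (hn : k < n - k) {x : Fin n → F} (hx : Function.Injective x) (β : Fin k → K)
    (hT : ∀ u, (toeplitzT β).mulVec u = 0 → u = 0)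
    (hw : ∀ v w : Fin n → K, v ≠ 0 →
      (∀ i < n - k, ∑ j, algebraMap F K (x j) ^ i * v j = 0) →
      (∀ i < n - k - k, ∑ j, algebraMap F K (x j) ^ i * w j = 0) →
      (∀ r : Fin k, ∑ j, algebraMap F K (x j) ^ (n - k - k + (r : ℕ)) * w j =
        -(toeplitzT β).mulVec (fun b => v (Fin.castLE (by omega) b)) r) →
      2 * (n - k) + 1 ≤ hammingNorm v + hammingNorm w) :
    ∃ 𝒞 : Submodule K[X] (Fin n → K[X]), IsMDPCode 𝒞 k k ∧ IsParityCheckMatrix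
      (polyMatrix ((Matrix.of fun (i : Fin (n - k)) (j : Fin n) => x j ^ (i : ℕ)).map
        (algebraMap F K)) (padZeroCols n (xHat (n - k) β))) 𝒞 := by
  have hkn : k ≤ n := by omega
  refine exists_isMDPCode (by omega) hk hn
    (fun v hv h => eq_zero_of_vandermonde_mulVec_eq_zero hx (by omega) hv h)
    (fun i j hj => by simp [padZeroCols, not_lt.2 hj]) (fun v hv j hj => ?_)
    fun v w hv0 h0 h1 => ?_
  · rw [padZeroCols_mulVec hkn] at hv
    refine congrFun (hT (fun b => v (Fin.castLE hkn b)) (funext fun r => ?_)) ⟨j, hj⟩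
    rw [← xHat_mulVec_add (m := n - k) β _ (i := ⟨n - k - k + r, by omega⟩) r rfl, hv]
    rfl
  · rw [padZeroCols_mulVec hkn] at h1
    refine hw v w hv0 (moments_eq_zero h0) (fun i hi => ?_) fun r => ?_
    · have := congrFun h1 ⟨i, by omega⟩
      rwa [Pi.add_apply, xHat_mulVec_of_lt β _ hi, vandermonde_map_mulVec, add_zero] at this
    · have := congrFun h1 ⟨n - k - k + r, by omega⟩
      rw [Pi.add_apply, xHat_mulVec_add β _ r rfl, vandermonde_map_mulVec] at this
      exact eq_neg_of_add_eq_zero_left this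

section ToeplitzSmall

variable {K : Type*} [Field K]

theorem toeplitzT_mulVec_two (b₁ b₂ : K) (u : Fin 2 → K) :
    (toeplitzT ![b₁, b₂]).mulVec u = ![b₁ * u 0, b₂ * u 0 + b₁ * u 1] := by
  funext r
  fin_cases r <;> simp [Matrix.mulVec, dotProduct, toeplitzT, Fin.sum_univ_two]

theorem toeplitzT_mulVec_three (b₁ b₂ b₃ : K) (u : Fin 3 → K) :
    (toeplitzT ![b₁, b₂, b₃]).mulVec u =
      ![b₁ * u 0, b₂ * u 0 + b₁ * u 1, b₃ * u 0 + b₂ * u 1 + b₁ * u 2] := by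
  funext r
  fin_cases r <;> simp [Matrix.mulVec, dotProduct, toeplitzT, Fin.sum_univ_three]

end ToeplitzSmall

/-! ### The two cases of the main theorem -/

theorem natDegree_minpoly_eq_finrank_of_prime {F K : Type*} [Field F] [Field K] [Algebra F K]
    (hp : (Module.finrank F K).Prime) {z : K} (hz : z ∉ Set.range (algebraMap F K)) :
    (minpoly F z).natDegree = Module.finrank F K := by
  have : FiniteDimensional F K := Module.finite_of_finrank_pos hp.pos
  rcases (Nat.dvd_prime hp).1 (minpoly.degree_dvd (K := F) (x := z)
    (Algebra.IsIntegral.isIntegral z)) with h | h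
  · exact absurd (minpoly.natDegree_eq_one_iff.1 h) hz
  · exact h

theorem mainTheorem4 {F K : Type*} [Field F] [Finite F] [Field K] [Algebra F K] (n : ℕ) :
    -- the case `k = δ = 2`, with `K` the extension of degree `2` of `F`
    (Module.finrank F K = 2 → 2 < n - 2 →
      ∀ H₀ : Matrix (Fin (n - 2)) (Fin n) F, IsVandermonde H₀ →
      ∀ β₁ β₂ : K, LinearIndependent F ![β₁, β₂] →
        ∃ 𝒞 : Submodule K[X] (Fin n → K[X]), IsMDPCode 𝒞 2 2 ∧
          IsParityCheckMatrix
            (polyMatrix (H₀.map (algebraMap F K)) (padZeroCols n (xHat (n - 2) ![β₁, β₂]))) 𝒞) ∧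
    -- the case `k = δ = 3`, with `K` the extension of degree `3` of `F`
    (Module.finrank F K = 3 → 3 < n - 3 →
      ∀ H₀ : Matrix (Fin (n - 3)) (Fin n) F, IsVandermonde H₀ →
      ∀ z : K, z ∉ Set.range (algebraMap F K) → (minpoly F z).coeff 0 ≠ -1 →
        ∃ 𝒞 : Submodule K[X] (Fin n → K[X]), IsMDPCode 𝒞 3 3 ∧
          IsParityCheckMatrix
            (polyMatrix (H₀.map (algebraMap F K)) (padZeroCols n (xHat (n - 3) ![z, z ^ 2, 1]))) 𝒞) := by
  refine ⟨fun _ hn H₀ hH β₁ β₂ hβ => ?_, fun hK hn H₀ hH z hz hz1 => ?_⟩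
  · obtain ⟨x, hx, rfl⟩ := hH
    have hβ₁ : β₁ ≠ 0 := hβ.ne_zero 0
    refine exists_isMDPCode_toeplitz (by omega) hn hx _ (fun u hu => ?_) fun v w hv h0 h1 h2 => ?_
    · rw [toeplitzT_mulVec_two] at hu
      have e₀ : u 0 = 0 := by simpa [hβ₁] using congrFun hu 0
      have e₁ : u 1 = 0 := by simpa [hβ₁, e₀] using congrFun hu 1
      funext r
      fin_cases r <;> assumption
    · rw [toeplitzT_mulVec_two] at h2
      -- `M = n - 2k` counts the zero rows above the Toeplitz block.
      obtain ⟨M, rfl⟩ : ∃ M, n = M + 4 := ⟨n - 4, by omega⟩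
      exact weight_bound_two hx (Fintype.card_fin _) (p := ⟨0, by omega⟩) (q := ⟨1, by omega⟩) (by simp) hβ hv h0 h1
        (h2 0) (h2 1)
  · obtain ⟨x, hx, rfl⟩ := hH
    have hd : (minpoly F z).natDegree = 3 :=
      (natDegree_minpoly_eq_finrank_of_prime (hK ▸ Nat.prime_three) hz).trans hK
    have hz0 : z ≠ 0 := fun h => hz ⟨0, by rw [h, map_zero]⟩
    refine exists_isMDPCode_toeplitz (by omega) hn hx _ (fun u hu => ?_) fun v w hv h0 h1 h2 => ?_
    · rw [toeplitzT_mulVec_three] at hu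
      have e₀ : u 0 = 0 := by simpa [hz0] using congrFun hu 0
      have e₁ : u 1 = 0 := by simpa [hz0, e₀] using congrFun hu 1
      have e₂ : u 2 = 0 := by simpa [hz0, e₀, e₁] using congrFun hu 2
      funext r
      fin_cases r <;> assumption
    · rw [toeplitzT_mulVec_three, one_mul] at h2
      obtain ⟨M, rfl⟩ : ∃ M, n = M + 6 := ⟨n - 6, by omega⟩
      exact weight_bound_three hx (Fintype.card_fin _) (p := ⟨0, by omega⟩) (q := ⟨1, by omega⟩)
        (r := ⟨2, by omega⟩) (by simp) (by simp) (by simp) hd hz1 hv h0 h1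
        (h2 0) (h2 1) (h2 2)
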